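/- Let $v_1,\dots,v_m\in\mathbb Z^d$, let $w_1,\dots,w_m$ be positive integers, and let $C'\subset\mathbb R^{d+1}$ be the cone generated by the vectors $(v_i,w_i)$, $i=1,\dots,m$. Suppose that $C'$ has an interior point and fix $x\in\operatorname{int}(C')$. For a facet $F$ of $C'$ let $\sigma_F$ be the corresponding support form, that is, the unique linear form with coprime integral coefficients such that $\sigma_F\ge 0$ on $C'$ and $F=\{y\in C':\sigma_F(y)=0\}$. The bottom facets of $C'$ are the facets $F$ for which the last coordinate of $\sigma_F$ is positive; the bottom of $C'$ is the set of all bottom facets and all their faces. Assume that all bottom facets are simplicial (generated by linearly independent vectors). With $v=(0,\dots,0,-1)\in\mathbb R^{d+1}$ put $\rho_F=-\sigma_F/\sigma_F(v)$ for each bottom facet $F$. Define $F<\tilde F$ if $\rho_F(x)<\rho_{\tilde F}(x)$, or if $\rho_F(x)=\rho_{\tilde F}(x)$ and $\rho_F$ precedes $\rho_{\tilde F}$ in the lexicographic order on $(\mathbb R^{d+1})^*$ (the order of coefficient vectors). Then $<$ is a strict total order on the finite set of bottom facets, and if $F_1<\dots<F_k$ are the bottom facets in this order, then $F_1,\dots,F_k$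 is a shelling of the bottom of $C'$: the bottom is a complex of simplicial cones whose maximal cones are exactly $F_1,\dots,F_k$, all of dimension $d$, and for every $i$ the set $F_i\cap(F_1\cup\dots\cup F_{i-1})$ is a union of facets of $F_i$ (the empty union for $i=1$). -/

import Mathlib

noncomputable section

namespace LiftedCone

open Module

/-- The dimension of a cone: the dimension of the linear subspace that it spans. -/
def coneDim {n : ℕ} (C : PointedCone ℝ (Fin n → ℝ)) : ℕ :=
  finrank ℝ (Submodule.span ℝ (C : Set (Fin n → ℝ)))

/-- A facet of `C` is a face of codimension one. -/
def IsFacet {n : ℕ} (F C : PointedCone ℝ (Fin n → ℝ)) : Prop :=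
  F.IsFaceOf C ∧ coneDim F + 1 = coneDim C

/-- A linear form is primitive if its coefficients are integers with greatest common divisor 1. -/
def IsPrimitive {n : ℕ} (σ : Dual ℝ (Fin n → ℝ)) : Prop :=
  ∃ a : Fin n → ℤ, (∀ i, σ (Pi.single i 1) = (a i : ℝ)) ∧ Finset.univ.gcd a = 1

/-- `σ` is a support form of `C` corresponding to the face `F`: it is primitive, nonnegative on
`C`, and `F` consists of the points of `C` at which it vanishes. -/
structure IsSupportForm {n : ℕ} (C F : PointedCone ℝ (Fin n → ℝ))
    (σ : Dual ℝ (Fin n → ℝ)) : Prop where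
  primitive : IsPrimitive σ
  nonneg : ∀ y ∈ C, 0 ≤ σ y
  mem_iff : ∀ y ∈ C, y ∈ F ↔ σ y = 0

open Classical in
/-- The support form `σ_F` of `C` corresponding to `F`. For a facet `F` of a full-dimensional
rational cone `C` it exists and is unique; where there is none, the value is `0`. -/
def supportForm {n : ℕ} (C F : PointedCone ℝ (Fin n → ℝ)) : Dual ℝ (Fin n → ℝ) :=
  if h : ∃ σ, IsSupportForm C F σ then h.choose else 0

/-- The cone `C'` in `ℝ^(d+1)` generated by the lifted vectors `(v_i, w_i)`. -/
def liftedCone {d m : ℕ} (v : Fin m → Fin d → ℤ) (w : Fin m → ℤ) :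
    PointedCone ℝ (Fin (d + 1) → ℝ) :=
  PointedCone.hull ℝ (Set.range fun i : Fin m =>
    Fin.snoc (α := fun _ => ℝ) (fun j => (v i j : ℝ)) (w i : ℝ))

/-- The vector `(0, …, 0, -1)`. -/
def down (d : ℕ) : Fin (d + 1) → ℝ := Pi.single (Fin.last d) (-1)

/-- The bottom facets: those whose support form has positive last coordinate. -/
def bottomFacets {d : ℕ} (C : PointedCone ℝ (Fin (d + 1) → ℝ)) :
    Set (PointedCone ℝ (Fin (d + 1) → ℝ)) :=
  {F | IsFacet F C ∧ 0 < supportForm C F (Pi.single (Fin.last d) 1)}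

/-- The bottom: the bottom facets and all their faces. -/
def bottom {d : ℕ} (C : PointedCone ℝ (Fin (d + 1) → ℝ)) :
    Set (PointedCone ℝ (Fin (d + 1) → ℝ)) :=
  {G | ∃ F ∈ bottomFacets C, G.IsFaceOf F}

/-- The normalized form `ρ_F = -σ_F / σ_F(0, …, 0, -1)`. -/
def normForm {d : ℕ} (C F : PointedCone ℝ (Fin (d + 1) → ℝ)) : Dual ℝ (Fin (d + 1) → ℝ) :=
  (-(supportForm C F (down d))⁻¹) • supportForm C F

/-- The coefficient vector of a linear form, in the lexicographically ordered space. -/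
def lexCoeff {n : ℕ} (ρ : Dual ℝ (Fin n → ℝ)) : Lex (Fin n → ℝ) :=
  toLex fun i => ρ (Pi.single i 1)

/-- `F` precedes `G`: compare `ρ_F(x)` and `ρ_G(x)`, and break ties by the lexicographic order
of `ρ_F` and `ρ_G`. -/
def Precedes {d : ℕ} (C : PointedCone ℝ (Fin (d + 1) → ℝ)) (x : Fin (d + 1) → ℝ)
    (F G : PointedCone ℝ (Fin (d + 1) → ℝ)) : Prop :=
  normForm C F x < normForm C G x ∨
    (normForm C F x = normForm C G x ∧ lexCoeff (normForm C F) < lexCoeff (normForm C G))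

/-- A (finite) complex of simplicial cones. -/
structure IsSimplicialComplex {n : ℕ} (K : Set (PointedCone ℝ (Fin n → ℝ))) : Prop where
  finite : K.Finite
  simplicial : ∀ D ∈ K, D.IsSimplicial
  face_mem : ∀ D ∈ K, ∀ G : PointedCone ℝ (Fin n → ℝ), G.IsFaceOf D → G ∈ K
  inter_face : ∀ D ∈ K, ∀ D' ∈ K, (D ⊓ D').IsFaceOf D ∧ (D ⊓ D').IsFaceOf D'

/-- `D 0, …, D (k-1)` is a shelling of `K`: `K` is a complex of simplicial cones whose maximal
cones all have dimension `e`, the `D i` are these maximal cones, each listed once, and each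
intersection `D i ∩ (D 0 ∪ ⋯ ∪ D (i-1))` is a union of facets of `D i` (the empty union
for `i = 0`). -/
structure IsShelling {n : ℕ} (K : Set (PointedCone ℝ (Fin n → ℝ))) (e : ℕ) {k : ℕ}
    (D : Fin k → PointedCone ℝ (Fin n → ℝ)) : Prop where
  isComplex : IsSimplicialComplex K
  pure : ∀ M, Maximal (· ∈ K) M → coneDim M = e
  injective : Function.Injective D
  range_eq : Set.range D = {M | Maximal (· ∈ K) M}
  inter_eq : ∀ i, ∃ S : Set (PointedCone ℝ (Fin n → ℝ)),
    (∀ G ∈ S, IsFacet G (D i)) ∧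
      (D i : Set (Fin n → ℝ)) ∩ (⋃ j, ⋃ (_ : j < i), (D j : Set (Fin n → ℝ))) =
        ⋃ G ∈ S, (G : Set (Fin n → ℝ))

end LiftedCone

end

/-! The order comes from moving along a vertical line. Write e for the last unit vector. By
`exists_perturbation`, x may be replaced by an interior point x' at which the tie-breaking becomes a
strict comparison of the values ρ_F(x'). The vertical line through x' meets the hyperplane spanned
by F at p = x' - ρ_F(x')e. Since ρ_H(e) = 1 for every bottom facet H, ρ_H(p) = ρ_H(x') - ρ_F(x'), so
the facets preceding F are those whose forms are negative at p. Let y lie in F and in an earlier F'.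
The form ρ_F' is nonnegative on F, zero at y and negative at p. In coordinates on the generators of
the simplicial cone F, some generator g therefore has coordinate zero in y and negative coordinate
in p (`exists_dual_neg`). The facet of F opposite g contains y. Across it lies another facet F'' of
C (`exists_adjacent_facet`), whose support form κ vanishes on the other generators of F and is
positive at g, so κ(p) < 0. As κ(x') > 0 and ρ_F(x') > 0, this forces κ(e) > 0: F'' is a bottom
facet, and it precedes F. -/

namespace LiftedCone

open Module PointedCone

/-! ### Faces of cones and coordinates on simplicial cones -/

section General

variable {E : Type*} [AddCommGroup E] [Module ℝ E]

/-- A face of the cone generated by `s` is generated by the elements of `s` it contains. -/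
theorem face_eq_hull {s : Set E} {G : PointedCone ℝ E} (hG : G.IsFaceOf (hull ℝ s)) :
    G = hull ℝ (s ∩ (G : Set E)) := by
  apply le_antisymm
  · intro y hy
    have key : ∀ z ∈ hull ℝ s, z ∈ G → z ∈ hull ℝ (s ∩ (G : Set E)) := by
      intro z hz
      induction hz using Submodule.span_induction with
      | mem z hz => exact fun hzG => subset_hull ⟨hz, hzG⟩
      | zero => exact fun _ => zero_mem _
      | add a b ha hb iha ihb =>
        intro hab
        obtain ⟨h₁, h₂⟩ := (hG.add_mem_iff_mem ha hb).1 hab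
        exact add_mem (iha h₁) (ihb h₂)
      | smul c z hz ih =>
        intro hcz
        rcases eq_or_lt_of_le c.2 with hc | hc
        · have : c = 0 := Subtype.ext hc.symm
          simp [this]
        · refine Submodule.smul_mem _ c (ih ?_)
          refine hG.mem_of_smul_add_mem (y := 0) hz (zero_mem _) hc ?_
          rw [add_zero]
          exact hcz
    exact key y (hG.le hy) hy
  · exact Submodule.span_le.2 Set.inter_subset_right

/-- A face is determined by the generators it contains. -/
theorem finite_faces {s : Set E} (hs : s.Finite) :
    {G : PointedCone ℝ E | G.IsFaceOf (hull ℝ s)}.Finite := by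
  refine Set.Finite.of_finite_image (f := fun G : PointedCone ℝ E => s ∩ (G : Set E))
    (hs.finite_subsets.subset ?_) ?_
  · rintro _ ⟨G, -, rfl⟩
    exact Set.inter_subset_left
  · intro G hG H hH h
    rw [face_eq_hull hG, face_eq_hull hH]
    exact congrArg (hull ℝ) h

theorem isSimplicial_of_isFaceOf {G D : PointedCone ℝ E} (hG : G.IsFaceOf D)
    (hD : D.IsSimplicial) : G.IsSimplicial := by
  obtain ⟨s, hs, hli, rfl⟩ := hD
  exact ⟨_, hs.inter_of_left _, hli.mono Set.inter_subset_left, (face_eq_hull hG).symm⟩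

/-- The points of `C` at which the linear form `σ` vanishes. -/
def zeroFace (C : PointedCone ℝ E) (σ : Dual ℝ E) : PointedCone ℝ E :=
  C ⊓ ofSubmodule (LinearMap.ker σ)

theorem mem_zeroFace {C : PointedCone ℝ E} {σ : Dual ℝ E} {y : E} :
    y ∈ zeroFace C σ ↔ y ∈ C ∧ σ y = 0 := Iff.rfl

theorem zeroFace_isFaceOf {C : PointedCone ℝ E} {σ : Dual ℝ E} (h : ∀ y ∈ C, 0 ≤ σ y) :
    (zeroFace C σ).IsFaceOf C := by
  refine IsFaceOf.of_mem_of_add_mem_left inf_le_left fun {y z} hy hz hyz => ?_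
  refine mem_zeroFace.2 ⟨hy, ?_⟩
  have := (mem_zeroFace.1 hyz).2
  rw [map_add] at this
  linarith [h y hy, h z hz]

theorem nonneg_on_hull {s : Set E} {σ : Dual ℝ E} (h : ∀ y ∈ s, 0 ≤ σ y) :
    ∀ y ∈ hull ℝ s, 0 ≤ σ y := by
  intro y hy
  induction hy using Submodule.span_induction with
  | mem y hy => exact h y hy
  | zero => simp
  | add a b _ _ iha ihb => rw [map_add]; exact add_nonneg iha ihb
  | smul c y _ ih =>
    have : σ (c • y) = (c : ℝ) * σ y := map_smul σ (c : ℝ) y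
    rw [this]
    exact mul_nonneg c.2 ih

theorem span_hull (s : Set E) :
    Submodule.span ℝ (hull ℝ s : Set E) = Submodule.span ℝ s :=
  Submodule.span_span_of_tower _ ℝ s

/-- Linear forms dual to a linearly independent set. -/
theorem exists_dual_family {s : Set E} (hli : LinearIndepOn ℝ id s) :
    ∃ τ : E → Dual ℝ E, (∀ g ∈ s, τ g g = 1) ∧ ∀ g ∈ s, ∀ h ∈ s, h ≠ g → τ g h = 0 := by
  have key : ∀ g : E, ∃ f : Dual ℝ E, g ∈ s → f g = 1 ∧ ∀ h ∈ s, h ≠ g → f h = 0 := by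
    intro g
    by_cases hg : g ∈ s
    · have hn := linearIndepOn_iff_notMem_span.1 hli g hg
      obtain ⟨f, hf, hle⟩ := Submodule.exists_le_ker_of_notMem hn
      refine ⟨(f g)⁻¹ • f, fun _ => ⟨inv_mul_cancel₀ hf, fun h hh hne => ?_⟩⟩
      have : f h = 0 := hle (Submodule.subset_span ⟨h, ⟨hh, hne⟩, rfl⟩)
      simp [this]
    · exact ⟨0, fun h => absurd h hg⟩
  choose τ hτ using key
  exact ⟨τ, fun g hg => (hτ g hg).1, fun g hg => (hτ g hg).2⟩

theorem sum_dual_family {s : Finset E} {τ : E → Dual ℝ E} (h₁ : ∀ g ∈ s, τ g g = 1)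
    (h₀ : ∀ g ∈ s, ∀ h ∈ s, h ≠ g → τ g h = 0) {z : E}
    (hz : z ∈ Submodule.span ℝ (s : Set E)) : ∑ g ∈ s, τ g z • g = z := by
  induction hz using Submodule.span_induction with
  | mem z hz =>
    rw [Finset.sum_eq_single_of_mem z hz, h₁ z hz, one_smul]
    intro g hg hne
    rw [h₀ g hg z hz hne.symm, zero_smul]
  | zero => simp
  | add a b _ _ iha ihb =>
    simp only [map_add, add_smul, Finset.sum_add_distrib, iha, ihb]
  | smul c z _ ih =>
    simp only [map_smul, smul_assoc, ← Finset.smul_sum, ih]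

theorem dual_family_nonneg {s : Set E} {τ : E → Dual ℝ E} (h₁ : ∀ g ∈ s, τ g g = 1)
    (h₀ : ∀ g ∈ s, ∀ h ∈ s, h ≠ g → τ g h = 0) {g : E} (hg : g ∈ s) :
    ∀ y ∈ hull ℝ s, 0 ≤ τ g y := by
  refine nonneg_on_hull fun y hy => ?_
  by_cases h : y = g
  · rw [h, h₁ g hg]; exact zero_le_one
  · rw [h₀ g hg y hy h]

/-- The facet of a simplicial cone opposite to a generator. -/
theorem zeroFace_dual_family {s : Set E} {τ : E → Dual ℝ E} (h₁ : ∀ g ∈ s, τ g g = 1)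
    (h₀ : ∀ g ∈ s, ∀ h ∈ s, h ≠ g → τ g h = 0) {g : E} (hg : g ∈ s) :
    zeroFace (hull ℝ s) (τ g) = hull ℝ (s \ {g}) := by
  rw [face_eq_hull (zeroFace_isFaceOf (dual_family_nonneg h₁ h₀ hg))]
  congr 1
  ext h
  constructor
  · rintro ⟨hh, hz⟩
    refine ⟨hh, ?_⟩
    rintro rfl
    have := (mem_zeroFace.1 hz).2
    rw [h₁ h hh] at this
    exact one_ne_zero this
  · rintro ⟨hh, hne⟩
    exact ⟨hh, mem_zeroFace.2 ⟨subset_hull hh, h₀ g hg h hh hne⟩⟩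

/-- A point `p` of the span of a simplicial cone that violates a form `φ` valid on the cone lies
beyond a facet of the cone through any given zero `y` of `φ`. -/
theorem exists_dual_neg {s : Finset E} {τ : E → Dual ℝ E} (h₁ : ∀ g ∈ s, τ g g = 1)
    (h₀ : ∀ g ∈ s, ∀ h ∈ s, h ≠ g → τ g h = 0) {φ : Dual ℝ E} (hφ : ∀ g ∈ s, 0 ≤ φ g)
    {y p : E} (hy : y ∈ hull ℝ (s : Set E)) (hφy : φ y = 0)
    (hp : p ∈ Submodule.span ℝ (s : Set E)) (hφp : φ p < 0) :
    ∃ g ∈ s, τ g y = 0 ∧ τ g p < 0 := by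
  have hpos : ∀ g ∈ s, 0 ≤ τ g y := fun g hg => dual_family_nonneg h₁ h₀ hg y hy
  have hys := sum_dual_family h₁ h₀ (hull_le_span ℝ _ hy)
  have hps := sum_dual_family h₁ h₀ hp
  -- These nonnegative terms add up to φ(y) = 0.
  have hzero : ∀ g ∈ s, τ g y * φ g = 0 := by
    refine (Finset.sum_eq_zero_iff_of_nonneg fun g hg => mul_nonneg (hpos g hg) (hφ g hg)).1 ?_
    rw [← hys] at hφy
    simpa [map_sum] using hφy
  -- Otherwise every term of φ(p) = ∑ τ_g(p) φ(g) is nonnegative: φ(g) = 0 wherever τ_g(y) ≠ 0.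
  by_contra! hcon
  refine absurd hφp (not_lt.2 ?_)
  rw [← hps, map_sum]
  refine Finset.sum_nonneg fun g hg => ?_
  rw [map_smul, smul_eq_mul]
  rcases mul_eq_zero.1 (hzero g hg) with h | h
  · exact mul_nonneg (hcon g hg h) (hφ g hg)
  · simp [h]

theorem eq_smul_of_ker_le {σ τ : Dual ℝ E} (h : LinearMap.ker σ ≤ LinearMap.ker τ) {x : E}
    (hx : σ x ≠ 0) : τ = (τ x / σ x) • σ := by
  ext y
  have hy : y - (σ y / σ x) • x ∈ LinearMap.ker σ := by
    simp [hx]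
  have := h hy
  rw [LinearMap.mem_ker, map_sub, map_smul, smul_eq_mul, sub_eq_zero] at this
  rw [this, LinearMap.smul_apply, smul_eq_mul]
  ring

theorem eq_ker_of_le [FiniteDimensional ℝ E] {σ : Dual ℝ E} (hσ : σ ≠ 0) {W : Submodule ℝ E}
    (hW : W ≤ LinearMap.ker σ) (hdim : finrank ℝ E ≤ finrank ℝ W + 1) :
    W = LinearMap.ker σ := by
  have h := Module.Dual.finrank_ker_add_one_of_ne_zero hσ
  have := Submodule.finrank_mono hW
  exact Submodule.eq_of_le_of_finrank_eq hW (by omega)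

end General

/-! ### Interior points and full-dimensionality -/

section Interior

variable {n : ℕ} {C : PointedCone ℝ (Fin n → ℝ)} {x : Fin n → ℝ}

/-- A nonzero form is an open map, so it sends the interior of C into the interior of [0, ∞). -/
theorem pos_of_mem_interior (hx : x ∈ interior (C : Set (Fin n → ℝ)))
    {σ : Dual ℝ (Fin n → ℝ)} (hσ : σ ≠ 0) (h : ∀ y ∈ C, 0 ≤ σ y) : 0 < σ x := by
  have hopen : IsOpen (σ '' interior (C : Set (Fin n → ℝ))) :=
    LinearMap.isOpenMap_of_finiteDimensional σ (LinearMap.surjective hσ) _ isOpen_interior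
  have hsub : σ '' interior (C : Set (Fin n → ℝ)) ⊆ Set.Ici 0 := by
    rintro _ ⟨y, hy, rfl⟩
    exact h y (interior_subset hy)
  have := interior_maximal hsub hopen ⟨x, hx, rfl⟩
  rwa [interior_Ici] at this

theorem span_eq_top_of_mem_interior (hx : x ∈ interior (C : Set (Fin n → ℝ))) :
    Submodule.span ℝ (C : Set (Fin n → ℝ)) = ⊤ :=
  Submodule.eq_top_of_nonempty_interior' _ ⟨x, interior_mono Submodule.subset_span hx⟩

theorem coneDim_of_mem_interior (hx : x ∈ interior (C : Set (Fin n → ℝ))) : coneDim C = n := by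
  rw [coneDim, span_eq_top_of_mem_interior hx, finrank_top, finrank_fin_fun]

end Interior

theorem coneDim_hull {n : ℕ} {s : Finset (Fin n → ℝ)}
    (hli : LinearIndepOn ℝ id (s : Set (Fin n → ℝ))) :
    coneDim (hull ℝ (s : Set (Fin n → ℝ))) = s.card := by
  rw [coneDim, span_hull, finrank_span_set_eq_card hli]
  simp

/-! ### Integrality: primitive support forms -/

theorem dual_apply_eq_sum {K : Type*} [Field K] {n : ℕ} (σ : Dual K (Fin n → K))
    (y : Fin n → K) : σ y = ∑ j, y j * σ (Pi.single j 1) := by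
  conv_lhs => rw [LinearMap.pi_apply_eq_sum_univ σ y]
  refine Finset.sum_congr rfl fun j _ => ?_
  rw [smul_eq_mul]
  congr 2
  ext k
  simp [Pi.single_apply, eq_comm]

theorem isPrimitive_neg {n : ℕ} {σ : Dual ℝ (Fin n → ℝ)} (h : IsPrimitive σ) :
    IsPrimitive (-σ) := by
  obtain ⟨a, ha, hg⟩ := h
  refine ⟨fun i => (-1) * a i, fun i => by simp [ha], ?_⟩
  rw [Finset.gcd_mul_left, hg, mul_one]
  rfl

/-- A nonzero real form that vanishes at integral vectors can be replaced by a primitive one. -/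
theorem exists_isPrimitive_vanishing {n : ℕ} {S : Set (Fin n → ℤ)} {τ : Dual ℝ (Fin n → ℝ)}
    (hτ : τ ≠ 0) (hS : ∀ u ∈ S, τ (fun j => (u j : ℝ)) = 0) :
    ∃ σ : Dual ℝ (Fin n → ℝ), IsPrimitive σ ∧ σ ≠ 0 ∧ ∀ u ∈ S, σ (fun j => (u j : ℝ)) = 0 := by
  -- The restriction φ of τ to rational vectors is nonzero and kills W, so W is proper and some
  -- nonzero rational form f kills it; clearing denominators and dividing by the gcd makes f
  -- primitive.
  let W : Submodule ℚ (Fin n → ℚ) := Submodule.span ℚ ((fun u j => (u j : ℚ)) '' S)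
  let φ : (Fin n → ℚ) →ₗ[ℚ] ℝ := Fintype.linearCombination ℚ (fun j => τ (Pi.single j 1))
  have hWφ : W ≤ LinearMap.ker φ := by
    refine Submodule.span_le.2 ?_
    rintro _ ⟨u, hu, rfl⟩
    have h := hS u hu
    rw [dual_apply_eq_sum] at h
    simp only [SetLike.mem_coe, LinearMap.mem_ker, φ, Fintype.linearCombination_apply]
    rw [← h]
    refine Finset.sum_congr rfl fun j _ => ?_
    rw [Rat.smul_def, Rat.cast_intCast]
  have hWtop : W < ⊤ := by
    refine lt_top_iff_ne_top.2 fun hW => hτ ?_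
    ext j
    have : Pi.single j 1 ∈ LinearMap.ker φ := hWφ (hW ▸ Submodule.mem_top)
    simpa [φ] using this
  obtain ⟨f, hf, hWf⟩ := Submodule.exists_le_ker_of_lt_top W hWtop
  obtain ⟨b, hb⟩ := IsLocalization.exist_integer_multiples (nonZeroDivisors ℤ) Finset.univ
    (fun j => f (Pi.single j 1))
  have hb0 : ((b : ℤ) : ℚ) ≠ 0 := by
    exact_mod_cast nonZeroDivisors.ne_zero b.2
  choose a ha using fun j => hb j (Finset.mem_univ j)
  have ha' : ∀ j, (a j : ℚ) = (b : ℤ) * f (Pi.single j 1) := by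
    intro j
    have := ha j
    simpa using this
  have hex : ∃ j, f (Pi.single j 1) ≠ 0 := by
    by_contra! h
    exact hf (LinearMap.pi_ext' fun j => LinearMap.ext_ring (by simpa using h j))
  obtain ⟨j₀, hj₀⟩ := hex
  obtain ⟨c, hc, hgcd⟩ := Finset.extract_gcd (s := Finset.univ) a ⟨j₀, Finset.mem_univ _⟩
  have ha0 : a j₀ ≠ 0 := by
    have : (a j₀ : ℚ) ≠ 0 := by rw [ha']; exact mul_ne_zero hb0 hj₀
    exact_mod_cast this
  have hc0 : c j₀ ≠ 0 := fun h => ha0 (by rw [hc j₀ (Finset.mem_univ _), h, mul_zero])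
  have hg0 : Finset.univ.gcd a ≠ 0 := fun h => ha0 (by
    rw [hc j₀ (Finset.mem_univ _), h, zero_mul])
  let σ : Dual ℝ (Fin n → ℝ) := Fintype.linearCombination ℝ (fun j => (c j : ℝ))
  have hσ : ∀ j, σ (Pi.single j 1) = (c j : ℝ) := fun j => by simp [σ]
  refine ⟨σ, ⟨c, hσ, hgcd⟩, fun h => hc0 ?_, fun u hu => ?_⟩
  · have := hσ j₀
    rw [h, LinearMap.zero_apply] at this
    exact_mod_cast this.symm
  · have hfu : f (fun j => (u j : ℚ)) = 0 := hWf (Submodule.subset_span ⟨u, hu, rfl⟩)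
    have hsum : ∑ j, (u j : ℚ) * f (Pi.single j 1) = 0 := by
      rw [← dual_apply_eq_sum, hfu]
    have hint : ∑ j, u j * a j = 0 := by
      have : ((∑ j, u j * a j : ℤ) : ℚ) = 0 := by
        push_cast
        simp only [ha', mul_left_comm _ ((b : ℤ) : ℚ), ← Finset.mul_sum, hsum, mul_zero]
      exact_mod_cast this
    have hint' : ∑ j, u j * c j = 0 := by
      have h2 : Finset.univ.gcd a * ∑ j, u j * c j = 0 := by
        rw [← hint, Finset.mul_sum]
        refine Finset.sum_congr rfl fun j hj => ?_
        conv_rhs => rw [hc j hj]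
        ring
      exact (mul_eq_zero.1 h2).resolve_left hg0
    rw [dual_apply_eq_sum]
    simp only [hσ]
    exact_mod_cast hint'

/-- A facet of a full-dimensional cone with integral generators has a support form. -/
theorem exists_isSupportForm {n : ℕ} {S : Set (Fin n → ℤ)} {C : PointedCone ℝ (Fin n → ℝ)}
    (hC : C = hull ℝ ((fun u j => (u j : ℝ)) '' S)) {x : Fin n → ℝ}
    (hx : x ∈ interior (C : Set (Fin n → ℝ))) {τ : Dual ℝ (Fin n → ℝ)} (hτ : τ ≠ 0)
    (hnn : ∀ y ∈ C, 0 ≤ τ y) (hF : IsFacet (zeroFace C τ) C) :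
    ∃ σ, IsSupportForm C (zeroFace C τ) σ := by
  obtain ⟨σ, hprim, hσ, hvan⟩ := exists_isPrimitive_vanishing
    (S := {u ∈ S | τ (fun j => (u j : ℝ)) = 0}) hτ fun u hu => hu.2
  have hspan : Submodule.span ℝ (zeroFace C τ : Set (Fin n → ℝ)) = LinearMap.ker τ := by
    refine eq_ker_of_le hτ (Submodule.span_le.2 fun y hy => (mem_zeroFace.1 hy).2) ?_
    have := hF.2
    rw [coneDim_of_mem_interior hx, coneDim] at this
    rw [finrank_fin_fun]
    exact this.ge
  have hker : LinearMap.ker τ ≤ LinearMap.ker σ := by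
    have hface := hF.1
    rw [hC] at hface
    rw [← hspan, hC, face_eq_hull hface, span_hull, Submodule.span_le]
    rintro _ ⟨⟨u, hu, rfl⟩, hy⟩
    exact hvan u ⟨hu, (mem_zeroFace.1 hy).2⟩
  have hτx := pos_of_mem_interior hx hτ hnn
  have heq := eq_smul_of_ker_le hker hτx.ne'
  have main : ∀ (σ' : Dual ℝ (Fin n → ℝ)) (r : ℝ), 0 < r → σ' = r • τ → IsPrimitive σ' →
      IsSupportForm C (zeroFace C τ) σ' := by
    intro σ' r hr h hp
    refine ⟨hp, fun y hy => ?_, fun y hy => ?_⟩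
    · rw [h]
      exact mul_nonneg hr.le (hnn y hy)
    · rw [mem_zeroFace, h, LinearMap.smul_apply, smul_eq_mul, mul_eq_zero]
      simp [hr.ne', hy]
  have hr0 : σ x / τ x ≠ 0 := fun h => hσ (by rw [heq, h, zero_smul])
  -- The primitive form is a multiple of τ of unknown sign; negate it if necessary.
  rcases lt_or_gt_of_ne hr0 with hr | hr
  · exact ⟨-σ, main (-σ) (-(σ x / τ x)) (neg_pos.2 hr)
      ((congrArg Neg.neg heq).trans (neg_smul _ _).symm) (isPrimitive_neg hprim)⟩
  · exact ⟨σ, main σ _ hr heq hprim⟩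

/-! ### Facets across a ridge -/

/-- Through the ridge of a simplicial facet opposite to a generator `g` there is another facet. -/
theorem exists_adjacent_facet {n : ℕ} {t : Finset (Fin n → ℝ)} {C : PointedCone ℝ (Fin n → ℝ)}
    (hC : C = hull ℝ (t : Set (Fin n → ℝ))) {x : Fin n → ℝ}
    (hx : x ∈ interior (C : Set (Fin n → ℝ))) {ρ : Dual ℝ (Fin n → ℝ)} (hρ : ρ ≠ 0)
    (hnn : ∀ y ∈ C, 0 ≤ ρ y) {s : Finset (Fin n → ℝ)}
    (hli : LinearIndepOn ℝ id (s : Set (Fin n → ℝ)))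
    (hs : zeroFace C ρ = hull ℝ (s : Set (Fin n → ℝ))) (hcard : s.card + 1 = n)
    {g : Fin n → ℝ} (hg : g ∈ s) :
    ∃ σ : Dual ℝ (Fin n → ℝ), (∀ y ∈ C, 0 ≤ σ y) ∧ (∀ h ∈ s, h ≠ g → σ h = 0) ∧ 0 < σ g ∧
      IsFacet (zeroFace C σ) C := by
  classical
  obtain ⟨τ, h₁, h₀⟩ := exists_dual_family hli
  have hsC : ∀ h ∈ s, h ∈ C ∧ ρ h = 0 := fun h hh =>
    mem_zeroFace.1 (hs ▸ subset_hull (s := (s : Set (Fin n → ℝ))) hh)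
  have htC : ∀ u ∈ t, u ∈ C := fun u hu => hC ▸ subset_hull (s := (t : Set (Fin n → ℝ))) hu
  have hne : (t.filter fun u => 0 < ρ u).Nonempty := by
    rw [Finset.filter_nonempty_iff]
    by_contra! h
    have hneg : ∀ y ∈ C, 0 ≤ (-ρ) y := by
      rw [hC]
      exact nonneg_on_hull fun u hu => neg_nonneg.2 (h u hu)
    have h1 := pos_of_mem_interior hx hρ hnn
    have h2 := hneg x (interior_subset hx)
    rw [LinearMap.neg_apply] at h2
    linarith
  -- Rotate the hyperplane about the ridge: r is the least value for which τ_g + rρ is nonnegative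
  -- on all generators off the facet, and u is a generator where it then vanishes. On the facet ρ =
  -- 0, so r has no effect there.
  obtain ⟨u, hu, hmax⟩ := Finset.exists_max_image _ (fun u => -(τ g u) / ρ u) hne
  obtain ⟨hut, hρu⟩ := Finset.mem_filter.1 hu
  set r : ℝ := -(τ g u) / ρ u with hr
  let σ : Dual ℝ (Fin n → ℝ) := τ g + r • ρ
  have hσ : ∀ y, σ y = τ g y + r * ρ y := fun y => rfl
  have hσu : σ u = 0 := by
    rw [hσ, hr, div_mul_cancel₀ _ hρu.ne', add_neg_cancel]
  have hσg : σ g = 1 := by rw [hσ, h₁ g hg, (hsC g hg).2, mul_zero, add_zero]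
  have hσs : ∀ h ∈ s, h ≠ g → σ h = 0 := fun h hh hne => by
    rw [hσ, h₀ g hg h hh hne, (hsC h hh).2, mul_zero, add_zero]
  have hσnn : ∀ y ∈ C, 0 ≤ σ y := by
    rw [hC]
    refine nonneg_on_hull fun y hy => ?_
    rw [hσ]
    rcases (hnn y (htC y hy)).eq_or_lt with h | h
    · rw [← h, mul_zero, add_zero]
      refine dual_family_nonneg h₁ h₀ hg y ?_
      rw [← hs]
      exact mem_zeroFace.2 ⟨htC y hy, h.symm⟩
    · have := hmax y (Finset.mem_filter.2 ⟨hy, h⟩)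
      rw [div_le_iff₀ h] at this
      linarith
  have hσ0 : σ ≠ 0 := fun h => by
    rw [h] at hσg
    exact zero_ne_one hσg
  refine ⟨σ, hσnn, hσs, hσg ▸ one_pos, zeroFace_isFaceOf hσnn, ?_⟩
  rw [coneDim_of_mem_interior hx]
  apply le_antisymm
  · have hle : Submodule.span ℝ (zeroFace C σ : Set (Fin n → ℝ)) ≤ LinearMap.ker σ :=
      Submodule.span_le.2 fun y hy => (mem_zeroFace.1 hy).2
    have h1 := Submodule.finrank_mono hle
    have h2 := Module.Dual.finrank_ker_add_one_of_ne_zero hσ0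
    rw [finrank_fin_fun] at h2
    rw [coneDim]
    omega
  -- ρ vanishes on s but not at u, so replacing g by u gives n - 1 independent vectors in the zero
  -- face.
  · have hu' : u ∉ Submodule.span ℝ ((s.erase g : Finset (Fin n → ℝ)) : Set (Fin n → ℝ)) := by
      intro hmem
      have hle : Submodule.span ℝ ((s.erase g : Finset (Fin n → ℝ)) : Set (Fin n → ℝ)) ≤
          LinearMap.ker ρ :=
        Submodule.span_le.2 fun y hy => (hsC y (Finset.mem_of_mem_erase hy)).2
      exact hρu.ne' (hle hmem)
    have hli' : LinearIndepOn ℝ id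
        ((insert u (s.erase g) : Finset (Fin n → ℝ)) : Set (Fin n → ℝ)) := by
      rw [Finset.coe_insert]
      exact (hli.mono (Finset.coe_subset.2 (Finset.erase_subset _ _))).id_insert hu'
    have hle : hull ℝ ((insert u (s.erase g) : Finset (Fin n → ℝ)) : Set (Fin n → ℝ)) ≤
        zeroFace C σ := by
      refine Submodule.span_le.2 ?_
      intro y hy
      rcases Finset.mem_insert.1 hy with rfl | hy
      · exact mem_zeroFace.2 ⟨htC y hut, hσu⟩
      · obtain ⟨hyg, hys⟩ := Finset.mem_erase.1 hy
        exact mem_zeroFace.2 ⟨(hsC y hys).1, hσs y hys hyg⟩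
    have h1 : coneDim (hull ℝ ((insert u (s.erase g) : Finset (Fin n → ℝ)) :
        Set (Fin n → ℝ))) ≤ coneDim (zeroFace C σ) :=
      Submodule.finrank_mono (Submodule.span_mono hle)
    have hu'' : u ∉ s.erase g := fun h => hu' (Submodule.subset_span h)
    rw [coneDim_hull hli', Finset.card_insert_of_notMem hu'', Finset.card_erase_of_mem hg] at h1
    have := Finset.card_pos.2 ⟨g, hg⟩
    omega

/-- The facet of a simplicial cone opposite to a generator is indeed a facet. -/
theorem isFacet_hull_erase {n : ℕ} [DecidableEq (Fin n → ℝ)] {s : Finset (Fin n → ℝ)}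
    (hli : LinearIndepOn ℝ id (s : Set (Fin n → ℝ))) {g : Fin n → ℝ} (hg : g ∈ s) :
    IsFacet (hull ℝ ((s.erase g : Finset (Fin n → ℝ)) : Set (Fin n → ℝ)))
      (hull ℝ (s : Set (Fin n → ℝ))) := by
  constructor
  · obtain ⟨τ, h₁, h₀⟩ := exists_dual_family hli
    rw [Finset.coe_erase, ← zeroFace_dual_family h₁ h₀ hg]
    exact zeroFace_isFaceOf (dual_family_nonneg h₁ h₀ hg)
  · rw [coneDim_hull hli, coneDim_hull (hli.mono (Finset.coe_subset.2 (Finset.erase_subset _ _))),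
      Finset.card_erase_add_one hg]

/-! ### Lexicographic order as an infinitesimal perturbation -/

open Filter Topology in
/-- A lexicographically positive vector has positive inner product with `(ε, ε², …)` for all
small `ε > 0`. -/
theorem eventually_sum_pow_pos {n : ℕ} {a : Fin n → ℝ} {i : Fin n} (hlt : ∀ j < i, a j = 0)
    (hi : 0 < a i) : ∀ᶠ ε : ℝ in 𝓝[>] 0, 0 < ∑ j : Fin n, ε ^ ((j : ℕ) + 1) * a j := by
  -- This is the sum divided by ε^(i+1), with value `a i` at ε = 0. The terms j < i vanish and are
  -- dropped, since the exponent j - i would truncate.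
  have hcont : Continuous fun ε : ℝ =>
      ∑ j : Fin n, if j < i then 0 else ε ^ ((j : ℕ) - i) * a j := by
    refine continuous_finsetSum _ fun j _ => ?_
    split_ifs
    · exact continuous_const
    · fun_prop
  have h0 : (∑ j : Fin n, if j < i then 0 else (0 : ℝ) ^ ((j : ℕ) - i) * a j) = a i := by
    rw [Finset.sum_eq_single_of_mem i (Finset.mem_univ _)]
    · simp
    · intro j _ hj
      split_ifs with h
      · rfl
      · have : (i : ℕ) < j := lt_of_le_of_ne (not_lt.1 h) fun h' => hj (Fin.ext h'.symm)
        rw [zero_pow (by omega), zero_mul]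
  have hev : ∀ᶠ ε : ℝ in 𝓝 0,
      0 < ∑ j : Fin n, if j < i then 0 else ε ^ ((j : ℕ) - i) * a j :=
    hcont.continuousAt.eventually (lt_mem_nhds (hi.trans_eq h0.symm))
  filter_upwards [hev.filter_mono nhdsWithin_le_nhds, self_mem_nhdsWithin] with ε hε hpos
  have : ∑ j : Fin n, ε ^ ((j : ℕ) + 1) * a j =
      ε ^ ((i : ℕ) + 1) * ∑ j : Fin n, if j < i then 0 else ε ^ ((j : ℕ) - i) * a j := by
    rw [Finset.mul_sum]
    refine Finset.sum_congr rfl fun j _ => ?_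
    split_ifs with h
    · rw [hlt j h]; simp
    · have h' : (i : ℕ) ≤ j := not_lt.1 h
      rw [← mul_assoc, ← pow_add]
      congr 2
      omega
  rw [this]
  exact mul_pos (pow_pos hpos _) hε

/-! ### Bottom facets, their normalized forms and their order -/

section Bottom

variable {d : ℕ} {C F G : PointedCone ℝ (Fin (d + 1) → ℝ)} {x : Fin (d + 1) → ℝ}

theorem isSupportForm_supportForm {n : ℕ} {C F : PointedCone ℝ (Fin n → ℝ)}
    (h : ∃ σ, IsSupportForm C F σ) : IsSupportForm C F (supportForm C F) := by
  rw [supportForm, dif_pos h]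
  exact h.choose_spec

/-- The default value 0 of `supportForm` has last coordinate 0, which membership in `bottomFacets`
excludes. -/
theorem isSupportForm_of_mem_bottomFacets (hF : F ∈ bottomFacets C) :
    IsSupportForm C F (supportForm C F) := by
  refine isSupportForm_supportForm ?_
  by_contra h
  have := hF.2
  rw [supportForm, dif_neg h] at this
  exact lt_irrefl _ this

theorem normForm_eq (C F : PointedCone ℝ (Fin (d + 1) → ℝ)) : normForm C F =
    (supportForm C F (Pi.single (Fin.last d) 1))⁻¹ • supportForm C F := by
  have : down d = -Pi.single (Fin.last d) 1 := by rw [down, Pi.single_neg]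
  rw [normForm, this, map_neg, inv_neg, neg_neg]

theorem normForm_nonneg (hF : F ∈ bottomFacets C) : ∀ y ∈ C, 0 ≤ normForm C F y := by
  intro y hy
  rw [normForm_eq]
  exact mul_nonneg (inv_nonneg.2 hF.2.le) ((isSupportForm_of_mem_bottomFacets hF).nonneg y hy)

theorem normForm_last (hF : F ∈ bottomFacets C) :
    normForm C F (Pi.single (Fin.last d) 1) = 1 := by
  rw [normForm_eq]
  exact inv_mul_cancel₀ hF.2.ne'

theorem normForm_ne_zero (hF : F ∈ bottomFacets C) : normForm C F ≠ 0 := by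
  intro h
  have := normForm_last hF
  rw [h] at this
  exact zero_ne_one this

theorem zeroFace_normForm (hF : F ∈ bottomFacets C) : zeroFace C (normForm C F) = F := by
  ext y
  have hs := isSupportForm_of_mem_bottomFacets hF
  rw [mem_zeroFace, normForm_eq, LinearMap.smul_apply, smul_eq_mul, mul_eq_zero]
  constructor
  · rintro ⟨hy, h⟩
    exact (hs.mem_iff y hy).2 (h.resolve_left (inv_ne_zero hF.2.ne'))
  · intro hy
    exact ⟨hF.1.1.le hy, Or.inr ((hs.mem_iff y (hF.1.1.le hy)).1 hy)⟩

theorem coneDim_of_mem_bottomFacets (hx : x ∈ interior (C : Set (Fin (d + 1) → ℝ)))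
    (hF : F ∈ bottomFacets C) : coneDim F = d := by
  have := hF.1.2
  rw [coneDim_of_mem_interior hx] at this
  omega

theorem span_of_mem_bottomFacets (hx : x ∈ interior (C : Set (Fin (d + 1) → ℝ)))
    (hF : F ∈ bottomFacets C) :
    Submodule.span ℝ (F : Set (Fin (d + 1) → ℝ)) = LinearMap.ker (normForm C F) := by
  refine eq_ker_of_le (normForm_ne_zero hF) (Submodule.span_le.2 fun y hy => ?_) ?_
  · rw [← zeroFace_normForm hF] at hy
    exact (mem_zeroFace.1 hy).2
  · have := coneDim_of_mem_bottomFacets hx hF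
    rw [coneDim] at this
    rw [this, finrank_fin_fun]

/-- Equal dimensions force equal spans, and F is cut out of C by its span. Hence bottom facets are
maximal in the bottom. -/
theorem eq_of_le_of_mem_bottomFacets (hx : x ∈ interior (C : Set (Fin (d + 1) → ℝ)))
    (hF : F ∈ bottomFacets C) (hG : G ∈ bottomFacets C) (h : F ≤ G) : F = G := by
  refine le_antisymm h fun y hy => ?_
  have hspan : Submodule.span ℝ (F : Set (Fin (d + 1) → ℝ)) =
      Submodule.span ℝ (G : Set (Fin (d + 1) → ℝ)) :=
    Submodule.eq_of_le_of_finrank_eq (Submodule.span_mono h)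
      ((coneDim_of_mem_bottomFacets hx hF).trans (coneDim_of_mem_bottomFacets hx hG).symm)
  rw [← zeroFace_normForm hF]
  refine mem_zeroFace.2 ⟨hG.1.1.le hy, ?_⟩
  have : y ∈ Submodule.span ℝ (F : Set (Fin (d + 1) → ℝ)) := by
    rw [hspan]
    exact Submodule.subset_span hy
  rwa [span_of_mem_bottomFacets hx hF] at this

theorem mem_bottom_of_mem_bottomFacets (hF : F ∈ bottomFacets C) : F ∈ bottom C :=
  ⟨F, hF, .rfl⟩

theorem isFaceOf_of_mem_bottom (hF : F ∈ bottom C) : F.IsFaceOf C := by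
  obtain ⟨G, hG, h⟩ := hF
  exact h.trans hG.1.1

theorem setOf_maximal_bottom (hx : x ∈ interior (C : Set (Fin (d + 1) → ℝ))) :
    {M | Maximal (· ∈ bottom C) M} = bottomFacets C := by
  ext M
  constructor
  · rintro ⟨⟨F, hF, hMF⟩, hmax⟩
    have : F ≤ M := hmax (mem_bottom_of_mem_bottomFacets hF) hMF.le
    rwa [le_antisymm hMF.le this]
  · intro hM
    refine ⟨mem_bottom_of_mem_bottomFacets hM, ?_⟩
    rintro G ⟨F, hF, hGF⟩ hMG
    rw [eq_of_le_of_mem_bottomFacets hx hM hF (hMG.trans hGF.le)]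
    exact hGF.le

theorem precedes_irrefl (C : PointedCone ℝ (Fin (d + 1) → ℝ)) (x : Fin (d + 1) → ℝ)
    (F : PointedCone ℝ (Fin (d + 1) → ℝ)) : ¬ Precedes C x F F := by
  rintro (h | ⟨-, h⟩)
  · exact lt_irrefl _ h
  · exact lt_irrefl _ h

theorem Precedes.trans {H : PointedCone ℝ (Fin (d + 1) → ℝ)} (h₁ : Precedes C x F G)
    (h₂ : Precedes C x G H) : Precedes C x F H := by
  rcases h₁ with h₁ | ⟨e₁, l₁⟩ <;> rcases h₂ with h₂ | ⟨e₂, l₂⟩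
  · exact Or.inl (h₁.trans h₂)
  · exact Or.inl (e₂ ▸ h₁)
  · exact Or.inl (e₁ ▸ h₂)
  · exact Or.inr ⟨e₁.trans e₂, l₁.trans l₂⟩

theorem lexCoeff_injective {n : ℕ} :
    Function.Injective (lexCoeff : Dual ℝ (Fin n → ℝ) → Lex (Fin n → ℝ)) := by
  intro σ τ h
  have h' : (fun i => σ (Pi.single i 1)) = fun i => τ (Pi.single i 1) := toLex.injective h
  ext i
  simpa using congrFun h' i

/-- Incomparable facets have the same normalized form, and a facet is the zero set of that form in
C. -/
theorem eq_of_not_precedes (hF : F ∈ bottomFacets C) (hG : G ∈ bottomFacets C)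
    (h₁ : ¬ Precedes C x F G) (h₂ : ¬ Precedes C x G F) : F = G := by
  simp only [Precedes, not_or, not_and, not_lt] at h₁ h₂
  have he : normForm C F x = normForm C G x := le_antisymm h₂.1 h₁.1
  have : normForm C F = normForm C G :=
    lexCoeff_injective (le_antisymm (not_lt.1 (h₂.2 he.symm)) (not_lt.1 (h₁.2 he)))
  rw [← zeroFace_normForm hF, this, zeroFace_normForm hG]

theorem isStrictTotalOrder_precedes (C : PointedCone ℝ (Fin (d + 1) → ℝ))
    (x : Fin (d + 1) → ℝ) :
    IsStrictTotalOrder (bottomFacets C) (fun F G => Precedes C x F G) where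
  trichotomous F G h₁ h₂ := Subtype.ext (eq_of_not_precedes F.2 G.2 h₁ h₂)
  irrefl F := precedes_irrefl C x F
  trans _ _ _ h₁ h₂ := h₁.trans h₂

open Filter Topology in
/-- The point `x` can be perturbed so that the lexicographic tie-breaking is decided by the values
at the perturbed point. -/
theorem exists_perturbation (hx : x ∈ interior (C : Set (Fin (d + 1) → ℝ)))
    (hfin : (bottomFacets C).Finite) :
    ∃ x' ∈ interior (C : Set (Fin (d + 1) → ℝ)), ∀ F ∈ bottomFacets C, ∀ G ∈ bottomFacets C,
      Precedes C x F G → normForm C F x' < normForm C G x' := by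
  -- For small ε > 0 a strict inequality at x persists, while a tie is decided by the first
  -- differing coefficient. Finitely many comparisons allow a common ε.
  let z : ℝ → Fin (d + 1) → ℝ := fun ε j => x j + ε ^ ((j : ℕ) + 1)
  have hzc : Continuous z := by
    refine continuous_pi fun j => ?_
    fun_prop
  have hz0 : z 0 = x := by
    ext j
    simp [z]
  have happly : ∀ (φ : Dual ℝ (Fin (d + 1) → ℝ)) (ε : ℝ),
      φ (z ε) = φ x + ∑ j : Fin (d + 1), ε ^ ((j : ℕ) + 1) * φ (Pi.single j 1) := by
    intro φ ε
    rw [dual_apply_eq_sum φ (z ε), dual_apply_eq_sum φ x, ← Finset.sum_add_distrib]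
    exact Finset.sum_congr rfl fun j _ => add_mul _ _ _
  have hint : ∀ᶠ ε in 𝓝[>] (0 : ℝ), z ε ∈ interior (C : Set (Fin (d + 1) → ℝ)) :=
    (hzc.continuousAt.eventually (isOpen_interior.mem_nhds (by rwa [hz0]))).filter_mono
      nhdsWithin_le_nhds
  have hcmp : ∀ᶠ ε in 𝓝[>] (0 : ℝ), ∀ F ∈ bottomFacets C, ∀ G ∈ bottomFacets C,
      Precedes C x F G → normForm C F (z ε) < normForm C G (z ε) := by
    rw [eventually_all_finite hfin]
    intro F hF
    rw [eventually_all_finite hfin]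
    intro G hG
    by_cases h : Precedes C x F G
    · simp only [h, true_imp_iff]
      rcases h with h | ⟨he, i, hlt, hi⟩
      · have hc : ∀ φ : Dual ℝ (Fin (d + 1) → ℝ), Tendsto (fun ε => φ (z ε)) (𝓝[>] 0) (𝓝 (φ x)) := by
          intro φ
          have := (φ.continuous_of_finiteDimensional.comp hzc).tendsto 0
          simp only [Function.comp_apply, hz0] at this
          exact this.mono_left nhdsWithin_le_nhds
        exact (hc _).eventually_lt (hc _) h
      · have := eventually_sum_pow_pos
          (a := fun j => (normForm C G - normForm C F) (Pi.single j 1)) (i := i)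
          (fun j hj => by
            have := hlt j hj
            simp only [lexCoeff] at this
            exact sub_eq_zero.2 this.symm)
          (sub_pos.2 hi)
        filter_upwards [this] with ε hε
        have h1 := happly (normForm C G - normForm C F) ε
        simp only [LinearMap.sub_apply, he, sub_self, zero_add] at h1 hε
        linarith
    · simp [h]
  obtain ⟨ε, h₁, h₂⟩ := (hint.and hcmp).exists
  exact ⟨z ε, h₁, h₂⟩

end Bottom

/-! ### The complex and its shelling -/

/-- The generators of the lifted cone, as integral vectors. -/
def liftedGenerators {d m : ℕ} (v : Fin m → Fin d → ℤ) (w : Fin m → ℤ) :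
    Set (Fin (d + 1) → ℤ) :=
  Set.range fun i => Fin.snoc (α := fun _ => ℤ) (v i) (w i)

theorem liftedCone_eq_hull {d m : ℕ} (v : Fin m → Fin d → ℤ) (w : Fin m → ℤ) :
    liftedCone v w = hull ℝ ((fun u j => (u j : ℝ)) '' liftedGenerators v w) := by
  rw [liftedCone, liftedGenerators, ← Set.range_comp]
  congr 2
  ext i j
  refine Fin.lastCases ?_ (fun j => ?_) j <;> simp

section Shelling

variable {d : ℕ} {S : Set (Fin (d + 1) → ℤ)} {C : PointedCone ℝ (Fin (d + 1) → ℝ)}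
  {x : Fin (d + 1) → ℝ}

theorem finite_bottom (hS : S.Finite) (hC : C = hull ℝ ((fun u j => (u j : ℝ)) '' S)) :
    (bottom C).Finite := by
  refine (finite_faces (hS.image fun u j => (u j : ℝ))).subset fun F hF => ?_
  rw [← hC]
  exact isFaceOf_of_mem_bottom hF

theorem finite_bottomFacets (hS : S.Finite) (hC : C = hull ℝ ((fun u j => (u j : ℝ)) '' S)) :
    (bottomFacets C).Finite :=
  (finite_bottom hS hC).subset fun _ => mem_bottom_of_mem_bottomFacets

theorem isSimplicialComplex_bottom (hS : S.Finite)
    (hC : C = hull ℝ ((fun u j => (u j : ℝ)) '' S))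
    (hsimp : ∀ F ∈ bottomFacets C, F.IsSimplicial) : IsSimplicialComplex (bottom C) where
  finite := finite_bottom hS hC
  simplicial := by
    rintro D ⟨F, hF, hD⟩
    exact isSimplicial_of_isFaceOf hD (hsimp F hF)
  face_mem := by
    rintro D ⟨F, hF, hD⟩ G hG
    exact ⟨F, hF, hG.trans hD⟩
  -- Both cones are faces of C, hence so is their intersection, and a face of C contained in another
  -- face of C is a face of it.
  inter_face D hD D' hD' := by
    have h := isFaceOf_of_mem_bottom hD
    have h' := isFaceOf_of_mem_bottom hD'
    exact ⟨((h.inf_left h').isFaceOf_iff_le h).2 inf_le_left,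
      ((h.inf_left h').isFaceOf_iff_le h').2 inf_le_right⟩

/-- Every point that a bottom facet `F` shares with a preceding bottom facet lies on a facet of
`F` that is contained in a preceding bottom facet. -/
theorem exists_facet_of_precedes (hS : S.Finite) (hC : C = hull ℝ ((fun u j => (u j : ℝ)) '' S))
    (hsimp : ∀ F ∈ bottomFacets C, F.IsSimplicial)
    (hx : x ∈ interior (C : Set (Fin (d + 1) → ℝ)))
    {F F' : PointedCone ℝ (Fin (d + 1) → ℝ)} (hF : F ∈ bottomFacets C) (hF' : F' ∈ bottomFacets C)
    (hprec : Precedes C x F' F) {y : Fin (d + 1) → ℝ} (hyF : y ∈ F) (hyF' : y ∈ F') :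
    ∃ G, IsFacet G F ∧ y ∈ G ∧ ∃ F'' ∈ bottomFacets C, Precedes C x F'' F ∧ G ≤ F'' := by
  classical
  obtain ⟨x', hx', hcmp⟩ := exists_perturbation hx (finite_bottomFacets hS hC)
  obtain ⟨s, hs, hli, hsF⟩ := hsimp F hF
  lift s to Finset (Fin (d + 1) → ℝ) using hs
  obtain ⟨τ, h₁, h₀⟩ := exists_dual_family hli
  have hcard : s.card = d := by
    rw [← coneDim_hull hli, hsF, coneDim_of_mem_bottomFacets hx hF]
  set e : Fin (d + 1) → ℝ := Pi.single (Fin.last d) 1 with he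
  set ρ := normForm C F with hρ
  -- The vertical projection of x' to the hyperplane spanned by F.
  set p : Fin (d + 1) → ℝ := x' - ρ x' • e with hp
  have hρp : ρ p = 0 := by
    rw [hp, map_sub, map_smul, hρ, normForm_last hF, smul_eq_mul, mul_one, sub_self]
  have hpspan : p ∈ Submodule.span ℝ (s : Set (Fin (d + 1) → ℝ)) := by
    rw [← span_hull, hsF, span_of_mem_bottomFacets hx hF]
    exact hρp
  have hval : ∀ H ∈ bottomFacets C, normForm C H p = normForm C H x' - ρ x' := by
    intro H hH
    rw [hp, map_sub, map_smul, normForm_last hH, smul_eq_mul, mul_one]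
  have hsC : ∀ g ∈ s, g ∈ C := fun g hg =>
    hF.1.1.le (hsF ▸ subset_hull (s := (s : Set (Fin (d + 1) → ℝ))) hg)
  have hF'p : normForm C F' p < 0 := by
    rw [hval F' hF']
    exact sub_neg.2 (hcmp F' hF' F hF hprec)
  have hF'y : normForm C F' y = 0 := by
    rw [← zeroFace_normForm hF'] at hyF'
    exact (mem_zeroFace.1 hyF').2
  obtain ⟨g, hg, hgy, hgp⟩ := exists_dual_neg h₁ h₀
    (fun g hg => normForm_nonneg hF' g (hsC g hg)) (hsF ▸ hyF) hF'y hpspan hF'p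
  obtain ⟨σ, hσnn, hσs, hσg, hσF⟩ := exists_adjacent_facet
    (t := (hS.image fun u j => (u j : ℝ)).toFinset) (by rw [Set.Finite.coe_toFinset]; exact hC) hx
    (normForm_ne_zero hF) (normForm_nonneg hF) hli ((zeroFace_normForm hF).trans hsF.symm)
    (by rw [hcard]) hg
  have hσ0 : σ ≠ 0 := by
    rintro rfl
    exact lt_irrefl _ hσg
  set F'' := zeroFace C σ with hF''
  -- Being a bottom facet is tested on the primitive form κ, so the sign information on σ must be
  -- transferred to κ.
  have hsup := isSupportForm_supportForm (exists_isSupportForm hC hx hσ0 hσnn hσF)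
  set κ := supportForm C F'' with hκ
  have hκs : ∀ h ∈ s, h ≠ g → κ h = 0 := fun h hh hne =>
    (hsup.mem_iff h (hsC h hh)).1 (mem_zeroFace.2 ⟨hsC h hh, hσs h hh hne⟩)
  have hκg : 0 < κ g := by
    refine lt_of_le_of_ne (hsup.nonneg g (hsC g hg)) fun h => hσg.ne' ?_
    exact (mem_zeroFace.1 ((hsup.mem_iff g (hsC g hg)).2 h.symm)).2
  -- Only the coordinate of p at g contributes: κ(p) = τ_g(p) κ(g).
  have hκp : κ p < 0 := by
    rw [← sum_dual_family h₁ h₀ hpspan, map_sum, Finset.sum_eq_single_of_mem g hg]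
    · rw [map_smul, smul_eq_mul]
      exact mul_neg_of_neg_of_pos hgp hκg
    · intro h hh hne
      rw [map_smul, hκs h hh hne, smul_zero]
  have hκ0 : κ ≠ 0 := by
    intro h
    rw [h] at hκg
    exact lt_irrefl _ hκg
  have hκx := pos_of_mem_interior hx' hκ0 hsup.nonneg
  have hρx := pos_of_mem_interior hx' (normForm_ne_zero hF) (normForm_nonneg hF)
  -- κ(p) = κ(x') - ρ(x') κ(e) is negative although κ(x') > 0.
  have hκe : 0 < κ e := by
    rw [hp, map_sub, map_smul, smul_eq_mul] at hκp
    exact pos_of_mul_pos_right (a := ρ x') (by linarith) hρx.le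
  have hbot : F'' ∈ bottomFacets C := ⟨hσF, hκe⟩
  have hlt : normForm C F'' x' < ρ x' := by
    rw [← sub_neg, ← hval F'' hbot, normForm_eq]
    exact mul_neg_of_pos_of_neg (inv_pos.2 hκe) hκp
  refine ⟨hull ℝ ((s.erase g : Finset (Fin (d + 1) → ℝ)) : Set (Fin (d + 1) → ℝ)),
    hsF ▸ isFacet_hull_erase hli hg, ?_, F'', hbot, ?_, ?_⟩
  · rw [Finset.coe_erase, ← zeroFace_dual_family h₁ h₀ hg]
    exact mem_zeroFace.2 ⟨hsF ▸ hyF, hgy⟩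
  · by_contra hn
    by_cases h : Precedes C x F F''
    · exact lt_asymm hlt (hcmp F hF F'' hbot h)
    · have := eq_of_not_precedes hbot hF hn h
      rw [this] at hlt
      exact lt_irrefl _ hlt
  · refine Submodule.span_le.2 fun h hh => ?_
    obtain ⟨hne, hhs⟩ := Finset.mem_erase.1 hh
    exact mem_zeroFace.2 ⟨hsC h hhs, hσs h hhs hne⟩

theorem isShelling_bottom (hS : S.Finite) (hC : C = hull ℝ ((fun u j => (u j : ℝ)) '' S))
    (hsimp : ∀ F ∈ bottomFacets C, F.IsSimplicial)
    (hx : x ∈ interior (C : Set (Fin (d + 1) → ℝ))) {k : ℕ}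
    {F : Fin k → PointedCone ℝ (Fin (d + 1) → ℝ)} (hrange : Set.range F = bottomFacets C)
    (hmono : ∀ i j, i < j → Precedes C x (F i) (F j)) : IsShelling (bottom C) d F where
  isComplex := isSimplicialComplex_bottom hS hC hsimp
  pure M hM := by
    refine coneDim_of_mem_bottomFacets hx ?_
    rw [← setOf_maximal_bottom hx]
    exact hM
  injective i j hij := by
    by_contra hne
    rcases lt_or_gt_of_ne hne with h | h
    · exact precedes_irrefl C x (F j) (hij ▸ hmono i j h)
    · exact precedes_irrefl C x (F j) (hij ▸ hmono j i h)
  range_eq := by rw [hrange, setOf_maximal_bottom hx]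
  inter_eq i := by
    have hmem : ∀ i, F i ∈ bottomFacets C := fun i => hrange ▸ Set.mem_range_self i
    refine ⟨{G | IsFacet G (F i) ∧ ∃ j < i, G ≤ F j}, fun G hG => hG.1, ?_⟩
    ext y
    simp only [Set.mem_inter_iff, Set.mem_iUnion, SetLike.mem_coe, exists_prop]
    constructor
    · rintro ⟨hy, j, hj, hyj⟩
      obtain ⟨G, hG, hyG, F'', hF'', hprec, hle⟩ := exists_facet_of_precedes hS hC hsimp hx
        (hmem i) (hmem j) (hmono j i hj) hy hyj
      obtain ⟨l, rfl⟩ : F'' ∈ Set.range F := hrange ▸ hF''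
      refine ⟨G, ⟨hG, l, ?_, hle⟩, hyG⟩
      -- An index l ≥ i would make F'' equal to `F i` or later than it, against `hprec`.
      by_contra hl
      rcases (not_lt.1 hl).eq_or_lt with h | h
      · exact precedes_irrefl C x (F l) (h ▸ hprec)
      · exact precedes_irrefl C x (F l) (hprec.trans (hmono i l h))
    · rintro ⟨G, ⟨hG, j, hj, hle⟩, hy⟩
      exact ⟨hG.1.le hy, j, hj, hle hy⟩

end Shelling

end LiftedCone

/-- Finiteness and the strict total order ensure that an increasing enumeration exists, so the final
clause is not vacuous. -/
theorem mainTheorem3 {d m : ℕ} (v : Fin m → Fin d → ℤ) (w : Fin m → ℤ) (hw : ∀ i, 0 < w i)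
    (hsimp : ∀ F ∈ LiftedCone.bottomFacets (LiftedCone.liftedCone v w), F.IsSimplicial)
    (x : Fin (d + 1) → ℝ)
    (hx : x ∈ interior (LiftedCone.liftedCone v w : Set (Fin (d + 1) → ℝ))) :
    (LiftedCone.bottomFacets (LiftedCone.liftedCone v w)).Finite ∧
    IsStrictTotalOrder (LiftedCone.bottomFacets (LiftedCone.liftedCone v w))
      (fun F G => LiftedCone.Precedes (LiftedCone.liftedCone v w) x F G) ∧
    ∀ (k : ℕ) (F : Fin k → PointedCone ℝ (Fin (d + 1) → ℝ)),
      Set.range F = LiftedCone.bottomFacets (LiftedCone.liftedCone v w) →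
      (∀ i j, i < j → LiftedCone.Precedes (LiftedCone.liftedCone v w) x (F i) (F j)) →
      LiftedCone.IsShelling (LiftedCone.bottom (LiftedCone.liftedCone v w)) d F := by
  have hS : (LiftedCone.liftedGenerators v w).Finite := Set.finite_range _
  have hC := LiftedCone.liftedCone_eq_hull v w
  exact ⟨LiftedCone.finite_bottomFacets hS hC, LiftedCone.isStrictTotalOrder_precedes _ x,
    fun k F hrange hmono => LiftedCone.isShelling_bottom hS hC hsimp hx hrange hmono⟩
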